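/- Let $\mathcal H_S$ be a two-dimensional complex Hilbert space (the system), let $\mathcal H_A$ be an arbitrary complex Hilbert space (the apparatus), and let $\hbar>0$. Let $H_S$ be a self-adjoint operator on $\mathcal H_S$, and let $H_A$ on $\mathcal H_A$ and $V$ on $\mathcal H_S\otimes\mathcal H_A$ be symmetric (in particular, self-adjoint), possibly unbounded, operators such that $$H=H_S\otimes \mathbf 1_A+\mathbf 1_S\otimes H_A+V,$$ defined on the intersection of the domains of the three summands, has a self-adjoint closure, again denoted by $H$. Let $U(t)=\exp(-iHt/\hbar)$ be the strongly continuous one-parameter unitary group generated by $-iH/\hbar$. Let $Q$ be an orthogonal projection on $\mathcal H_S$ with unit eigenvectors $q_0,q_1$ satisfying $Qq_0=0$ and $Qq_1=q_1$. For a unit vector $\Omega\in\mathcal H_A$ and $j=0,1$ let $$\rho_j^A(\tau)=\mathrm{tr}_{\mathcal H_S}\bigl(U(\tau)\,(|q_j\rangle\langle q_j|\otimes|\Omega\rangle\langle\Omega|)\,U(\tau)^*\bigr)$$ be the state of the apparatus at time $\tau$ when the initial state of the system is $|q_j\rangle$, and let $F(\rho,\sigma)=\mathrm{tr}\sqrt{\sigma^{1/2}\rho\,\sigma^{1/2}}$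 denote the fidelity. Then, for every unit vector $\Omega\in\mathcal H_A$ and every $\tau\ge 0$, $$\Vert [Q,H_S]\Vert\le \Vert H_S\Vert\,F(\rho_0^A(\tau),\rho_1^A(\tau))+\frac{\tau}{\hbar}\,\Vert [V,H_S\otimes\mathbf 1_A]\Vert .$$ Here $\Vert\cdot\Vert$ is the operator norm $\Vert X\Vert=\sup_{\phi\ne0}\Vert X\phi\Vert/\Vert\phi\Vert\in[0,\infty]$. For the commutator $[V,H_S\otimes\mathbf 1_A]$ the supremum is over the nonzero vectors in the domain of $V$, and the norm is $\infty$ if $H_S\otimes\mathbf 1_A$ does not map the domain of $V$ into itself. (The product $0\cdot\infty$ is $0$.) -/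

import Mathlib

open scoped TensorProduct ENNReal InnerProductSpace

noncomputable section

namespace QMeasurement

section Operators

variable {E : Type*} [NormedAddCommGroup E] [InnerProductSpace ℂ E]

/-- The trace of a positive bounded operator, `∑ i ⟪b i, T (b i)⟫` over a Hilbert basis `b`,
with values in `[0, ∞]`. -/
def posTrace [CompleteSpace E] (T : E →L[ℂ] E) : ℝ≥0∞ :=
  ∑' i, ENNReal.ofReal
    (⟪(exists_hilbertBasis ℂ E).choose_spec.choose i,
      T ((exists_hilbertBasis ℂ E).choose_spec.choose i)⟫_ℂ).re

/-- The fidelity `tr √(σ^{1/2} ρ σ^{1/2})` of two positive bounded operators. -/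
def fidelity [CompleteSpace E] (ρ σ : E →L[ℂ] E) : ℝ≥0∞ :=
  posTrace (CFC.sqrt (CFC.sqrt σ * ρ * CFC.sqrt σ))

/-- The operator norm in `[0, ∞]` of the commutator `[V, B] = V B - B V` of a possibly unbounded
operator `V` with a bounded operator `B`: the supremum of `‖[V, B] φ‖ / ‖φ‖` over the nonzero `φ`
in the domain of `V`. It is `∞` if `B` does not map the domain of `V` into itself, so that `[V, B]`
is not defined on all of that domain. -/
def commutatorNorm (V : E →ₗ.[ℂ] E) (B : E →L[ℂ] E) : ℝ≥0∞ :=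
  open Classical in
  ⨆ (φ : V.domain) (_ : φ ≠ 0),
    if h : B φ ∈ V.domain then ‖V ⟨B φ, h⟩ - B (V φ)‖ₑ / ‖(φ : E)‖ₑ else ∞

/-- `U t = exp (-i t H / ħ)` for all times `t`: `U` is the strongly continuous one-parameter
unitary group whose infinitesimal generator is `-i H / ħ`. That is, `φ` lies in the domain of `H`
and `H φ = χ` if and only if `U t φ` is differentiable at `t = 0` with derivative `-(i / ħ) χ`.
By Stone's theorem such a `U` exists if and only if `H` is self-adjoint. -/
structure IsTimeEvolution (ħ : ℝ) (H : E →ₗ.[ℂ] E) (U : ℝ → (E ≃ₗᵢ[ℂ] E)) : Prop where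
  add : ∀ s t φ, U (s + t) φ = U s (U t φ)
  continuous : ∀ φ, Continuous fun t => U t φ
  generator : ∀ φ χ,
    (φ, χ) ∈ H.graph ↔ HasDerivAt (fun t => U t φ) (-(Complex.I / (ħ : ℂ)) • χ) 0

end Operators

section Composite

variable {S A : Type*} [NormedAddCommGroup S] [InnerProductSpace ℂ S]
  [NormedAddCommGroup A] [InnerProductSpace ℂ A]

/-- `1 ⊗ T` for a possibly unbounded operator `T`, with domain `S ⊗ dom T`. -/
def idTensor (S : Type*) [NormedAddCommGroup S] [InnerProductSpace ℂ S] (T : A →ₗ.[ℂ] A) :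
    (S ⊗[ℂ] A) →ₗ.[ℂ] (S ⊗[ℂ] A) where
  domain := LinearMap.range (T.domain.subtype.lTensor S)
  toFun := T.toFun.lTensor S ∘ₗ
    (LinearEquiv.ofInjective (T.domain.subtype.lTensor S)
      (Module.Flat.lTensor_preserves_injective_linearMap _ T.domain.injective_subtype)).symm

/-- The total Hamiltonian `H_S ⊗ 1 + 1 ⊗ H_A + V`: the closure of the operator sum, which is
defined on the intersection of the domains of the summands. -/
def totalHamiltonian (HS : S →L[ℂ] S) (HA : A →ₗ.[ℂ] A) (V : (S ⊗[ℂ] A) →ₗ.[ℂ] (S ⊗[ℂ] A)) :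
    (S ⊗[ℂ] A) →ₗ.[ℂ] (S ⊗[ℂ] A) :=
  ((HS.rTensor A).toLinearMap.toPMap ⊤ + idTensor S HA + V).closure

/-- The operator `⟨s| ⊗ 1`, which maps `x ⊗ a` to `⟪s, x⟫ a`. -/
def bra (A : Type*) [NormedAddCommGroup A] [InnerProductSpace ℂ A] (s : S) :
    (S ⊗[ℂ] A) →L[ℂ] A :=
  (TensorProduct.lidIsometry ℂ A).toContinuousLinearEquiv.toContinuousLinearMap ∘L
    (innerSL ℂ s).rTensor A

/-- The partial trace over `S`, `∑ i (⟨e i| ⊗ 1) T (|e i⟩ ⊗ 1)` for an orthonormal basis `e`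
of the finite-dimensional space `S`. -/
def partialTrace [FiniteDimensional ℂ S] (T : (S ⊗[ℂ] A) →L[ℂ] (S ⊗[ℂ] A)) : A →L[ℂ] A :=
  ∑ i, bra A (stdOrthonormalBasis ℂ S i) ∘L T ∘L
    TensorProduct.mkL ℂ S A (stdOrthonormalBasis ℂ S i)

/-- The state of the apparatus after the unitary `U` has acted on `|q⟩⟨q| ⊗ |Ω⟩⟨Ω|`:
the partial trace over `S` of `U (|q⟩⟨q| ⊗ |Ω⟩⟨Ω|) U*`. -/
def apparatusState [FiniteDimensional ℂ S] (U : (S ⊗[ℂ] A) ≃ₗᵢ[ℂ] (S ⊗[ℂ] A)) (q : S) (Ω : A) :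
    A →L[ℂ] A :=
  partialTrace (U.toContinuousLinearEquiv.toContinuousLinearMap ∘L
    TensorProduct.mapL (InnerProductSpace.rankOne ℂ q q) (InnerProductSpace.rankOne ℂ Ω Ω) ∘L
    U.symm.toContinuousLinearEquiv.toContinuousLinearMap)

end Composite

end QMeasurement

end

/-!
Write `B = H_S ⊗ 1` and `c = ⟪q₁, H_S q₀⟫`. In the orthonormal basis `q₀, q₁` the commutator
`[Q, H_S]` is off-diagonal with entries of modulus `|c|`, so its norm is `|c|`
(`norm_commutator_le`), and `c = ⟪q₁ ⊗ Ω, B (q₀ ⊗ Ω)⟫`. Two estimates bound this number.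

*Evolution.* `B` commutes with `H_S ⊗ 1` and `1 ⊗ H_A`, so the form of `[H, B]` is that of `[V, B]`
and is bounded by `‖[V, B]‖`, first on the domain of the operator sum and by continuity on the graph
of its closure `H` (`norm_inner_sub_inner_le_of_mem_graph_totalHamiltonian`). Hence the derivative
of `⟪U t φ, B (U t χ)⟫` is at most `‖[V, B]‖ ‖φ‖ ‖χ‖ / ħ` for `φ`, `χ` in the domain of `H`, which
is dense, and the mean value inequality gives that replacing `q_j ⊗ Ω` by `ψ_j = U τ (q_j ⊗ Ω)`
changes the matrix element of `B` by at most `τ ‖[V, B]‖ / ħ`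
(`IsTimeEvolution.norm_inner_sub_inner_le`). Working with forms, rather than with `[H, B]` itself,
avoids the question whether `B` preserves the domain of `H`.

*Fidelity.* `|⟪ψ₁, B ψ₀⟫| ≤ ‖H_S‖ F(ρ₀, ρ₁)` is a version of one half of Uhlmann's theorem
(`enorm_inner_rTensor_le`). With `σ = ρ₁`, take a Schmidt decomposition
`(1 ⊗ √σ) ψ₀ = ∑ k, v k ⊗ w k`, where `v` is an orthonormal basis of `S`, `w k = √σ (b k)` are
orthogonal and `ψ₀ = ∑ k, v k ⊗ b k`. Then `√σ ρ₀ √σ = ∑ k, |w k⟩⟨w k|` has the eigenvectors `w k`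
with eigenvalues `‖w k‖²`, so that `F(ρ₀, ρ₁) ≥ ∑ k, ‖w k‖`. On the other hand
`⟪ψ₁, B ψ₀⟫ = ∑ k, ⟪ψ₁, H_S (v k) ⊗ b k⟫`, and by Cauchy-Schwarz each term is at most
`‖H_S (v k)‖ ‖√σ (b k)‖ ≤ ‖H_S‖ ‖w k‖`.
-/

namespace QMeasurement

/-! ### Traces of positive operators -/

section Trace

variable {E : Type*} [NormedAddCommGroup E] [InnerProductSpace ℂ E]

theorem tsum_enorm_inner_sq {ι : Type*} (b : HilbertBasis ι ℂ E) (x : E) :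
    ∑' i, ‖⟪b i, x⟫_ℂ‖ₑ ^ 2 = ‖x‖ₑ ^ 2 := by
  have h : HasSum (fun i => ‖⟪b i, x⟫_ℂ‖ ^ 2) (‖x‖ ^ 2) := by
    have h := Complex.hasSum_re (b.hasSum_inner_mul_inner x x)
    have h1 (i : ι) : (⟪x, b i⟫_ℂ * ⟪b i, x⟫_ℂ).re = ‖⟪b i, x⟫_ℂ‖ ^ 2 := by
      rw [← inner_conj_symm x, ← Complex.normSq_eq_conj_mul_self, Complex.normSq_eq_norm_sq,
        Complex.ofReal_re]
    have h2 : (⟪x, x⟫_ℂ).re = ‖x‖ ^ 2 := inner_self_eq_norm_sq (𝕜 := ℂ) x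
    simpa only [h1, h2] using h
  have := ENNReal.ofReal_tsum_of_nonneg (fun i => by positivity) h.summable
  rw [h.tsum_eq] at this
  simpa [ENNReal.ofReal_pow, ofReal_norm] using this.symm

variable [CompleteSpace E]

theorem inner_sqrt_left (T : E →L[ℂ] E) (x y : E) :
    ⟪CFC.sqrt T x, y⟫_ℂ = ⟪x, CFC.sqrt T y⟫_ℂ :=
  ((ContinuousLinearMap.nonneg_iff_isPositive _).1 (CFC.sqrt_nonneg T)).isSymmetric x y

theorem sqrt_sqrt_apply {T : E →L[ℂ] E} (hT : 0 ≤ T) (x : E) :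
    CFC.sqrt T (CFC.sqrt T x) = T x :=
  congr($(CFC.sqrt_mul_sqrt_self T hT) x)

theorem ofReal_re_inner_eq_enorm_sqrt_sq {T : E →L[ℂ] E} (hT : 0 ≤ T) (x : E) :
    ENNReal.ofReal (⟪x, T x⟫_ℂ).re = ‖CFC.sqrt T x‖ₑ ^ 2 := by
  rw [← sqrt_sqrt_apply hT x, ← inner_sqrt_left, inner_self_eq_norm_sq_to_K]
  simp [← Complex.ofReal_pow, ENNReal.ofReal_pow, ofReal_norm]

/-- The diagonal sum of a positive operator over a finite orthonormal family is at most its trace.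
For `T = D²` this is `∑ k, ‖D u k‖² = ∑ k, ∑ i, |⟪b i, D u k⟫|² ≤ ∑ i, ‖D b i‖²`, by Parseval for
the Hilbert basis `b` and Bessel for `u`. -/
theorem sum_inner_le_posTrace {κ : Type*} [Fintype κ] {u : κ → E} (hu : Orthonormal ℂ u)
    {T : E →L[ℂ] E} (hT : 0 ≤ T) :
    ∑ k, ENNReal.ofReal (⟪u k, T (u k)⟫_ℂ).re ≤ posTrace T := by
  unfold posTrace
  set b := (exists_hilbertBasis ℂ E).choose_spec.choose
  simp only [ofReal_re_inner_eq_enorm_sqrt_sq hT]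
  calc ∑ k, ‖CFC.sqrt T (u k)‖ₑ ^ 2
      = ∑ k, ∑' i, ‖⟪b i, CFC.sqrt T (u k)⟫_ℂ‖ₑ ^ 2 := by simp only [tsum_enorm_inner_sq]
    _ = ∑' i, ∑ k, ‖⟪b i, CFC.sqrt T (u k)⟫_ℂ‖ₑ ^ 2 :=
        (Summable.tsum_finsetSum fun _ _ => ENNReal.summable).symm
    _ ≤ ∑' i, ‖CFC.sqrt T (b i)‖ₑ ^ 2 := by
        refine ENNReal.tsum_le_tsum fun i => ?_
        have h := ENNReal.ofReal_le_ofReal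
          (hu.sum_inner_products_le (CFC.sqrt T (b i)) (s := Finset.univ))
        rw [ENNReal.ofReal_sum_of_nonneg fun _ _ => by positivity] at h
        have e (k : κ) : ‖⟪b i, CFC.sqrt T (u k)⟫_ℂ‖ₑ = ‖⟪u k, CFC.sqrt T (b i)⟫_ℂ‖ₑ := by
          rw [← inner_sqrt_left, ← ofReal_norm, norm_inner_symm, ofReal_norm]
        simpa only [e, ENNReal.ofReal_pow (norm_nonneg _), ofReal_norm] using h

/-- An eigenvector of a positive operator is an eigenvector of its square root. -/
theorem sqrt_apply_eq_of_apply_eq {T : E →L[ℂ] E} (hT : 0 ≤ T) {c : ℝ} (hc : 0 < c) {x : E}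
    (hx : T x = ((c : ℂ) ^ 2) • x) : CFC.sqrt T x = (c : ℂ) • x := by
  -- `y = (√T - c) x` is annihilated by `√T + c`, which is bounded below by `c`.
  set y := CFC.sqrt T x - (c : ℂ) • x with hy
  have h : CFC.sqrt T y = -((c : ℂ) • y) := by
    rw [hy, map_sub, sqrt_sqrt_apply hT, hx, map_smul]
    module
  have h1 : 0 ≤ (⟪y, CFC.sqrt T y⟫_ℂ).re :=
    ((ContinuousLinearMap.nonneg_iff_isPositive _).1 (CFC.sqrt_nonneg T)).re_inner_nonneg_right y
  rw [h, inner_neg_right, inner_smul_right, inner_self_eq_norm_sq_to_K] at h1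
  have h2 : c * ‖y‖ ^ 2 ≤ 0 := by
    have : (-((c : ℂ) * (‖y‖ : ℂ) ^ 2)).re = -(c * ‖y‖ ^ 2) := by norm_cast
    have h1' : 0 ≤ (-((c : ℂ) * (‖y‖ : ℂ) ^ 2)).re := h1
    linarith
  have h3 : ‖y‖ = 0 := by
    by_contra h0
    have : 0 < c * ‖y‖ ^ 2 := by positivity
    linarith
  exact sub_eq_zero.1 (norm_eq_zero.1 h3)

/-- If `R` is positive and the vectors `w k` are orthogonal with `R (w k) = ‖w k‖² w k`, then
`tr √R ≥ ∑ k, ‖w k‖`. -/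
theorem sum_enorm_le_posTrace_sqrt {κ : Type*} [Fintype κ] {w : κ → E}
    (hw : Pairwise fun i j => ⟪w i, w j⟫_ℂ = 0) {R : E →L[ℂ] E} (hR : 0 ≤ R)
    (hRw : ∀ k, R (w k) = ((‖w k‖ : ℂ) ^ 2) • w k) :
    ∑ k, ‖w k‖ₑ ≤ posTrace (CFC.sqrt R) := by
  classical
  let u : {k // w k ≠ 0} → E := fun k => ((‖w k‖⁻¹ : ℝ) : ℂ) • w k
  have hu : Orthonormal ℂ u := by
    refine ⟨fun k => ?_, fun i j hij => ?_⟩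
    · have : ‖w k‖ ≠ 0 := norm_ne_zero_iff.2 k.2
      simp [u, norm_smul, this]
    · simp [u, inner_smul_left, inner_smul_right, hw (Subtype.coe_injective.ne hij)]
  have key (k : {k // w k ≠ 0}) :
      ENNReal.ofReal (⟪u k, CFC.sqrt R (u k)⟫_ℂ).re = ‖w k‖ₑ := by
    have h0 : 0 < ‖w k‖ := norm_pos_iff.2 k.2
    have h1 : CFC.sqrt R (u k) = (‖w k‖ : ℂ) • u k := by
      simp only [u, map_smul]
      rw [sqrt_apply_eq_of_apply_eq hR h0 (hRw k), smul_comm]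
    rw [h1, inner_smul_right, inner_self_eq_norm_sq_to_K, hu.1 k, ← ofReal_norm]
    simp
  calc ∑ k, ‖w k‖ₑ = ∑ k : {k // w k ≠ 0}, ‖w k‖ₑ := by
        rw [← Finset.sum_filter_of_ne (p := fun k => w k ≠ 0) fun k _ h => by simpa using h]
        exact Finset.sum_subtype _ (by simp) _
    _ = ∑ k, ENNReal.ofReal (⟪u k, CFC.sqrt R (u k)⟫_ℂ).re := by simp only [key]
    _ ≤ _ := sum_inner_le_posTrace hu (CFC.sqrt_nonneg R)

end Trace

/-! ### Reduced states and purifications -/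

section Reduction

variable {S A : Type*} [NormedAddCommGroup S] [InnerProductSpace ℂ S]
  [NormedAddCommGroup A] [InnerProductSpace ℂ A]

@[simp]
theorem bra_tmul (s x : S) (a : A) : bra A s (x ⊗ₜ[ℂ] a) = ⟪s, x⟫_ℂ • a := by
  simp [bra]

theorem inner_bra_left (s : S) (ψ : S ⊗[ℂ] A) (a : A) :
    ⟪bra A s ψ, a⟫_ℂ = ⟪ψ, s ⊗ₜ[ℂ] a⟫_ℂ := by
  induction ψ using TensorProduct.induction_on with
  | zero => simp
  | tmul x y => simp [mul_comm]
  | add x y hx hy => simp [inner_add_left, hx, hy]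

theorem inner_smul_tmul (ψ : S ⊗[ℂ] A) (c : ℂ) (s : S) (a : A) :
    ⟪ψ, (c • s) ⊗ₜ[ℂ] a⟫_ℂ = c * ⟪ψ, s ⊗ₜ[ℂ] a⟫_ℂ := by
  rw [← TensorProduct.smul_tmul']
  exact inner_smul_right (𝕜 := ℂ) ψ _ c

theorem bra_lTensor (s : S) (D : A →L[ℂ] A) (ψ : S ⊗[ℂ] A) :
    bra A s (D.lTensor S ψ) = D (bra A s ψ) := by
  induction ψ using TensorProduct.induction_on with
  | zero => simp
  | tmul x y => simp
  | add x y hx hy => simp only [map_add, hx, hy]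

theorem sum_tmul_bra {ι : Type*} [Fintype ι] (v : OrthonormalBasis ι ℂ S) (ψ : S ⊗[ℂ] A) :
    ∑ i, v i ⊗ₜ[ℂ] bra A (v i) ψ = ψ := by
  induction ψ using TensorProduct.induction_on with
  | zero => simp
  | tmul x y => simp [TensorProduct.tmul_smul, TensorProduct.smul_tmul', ← TensorProduct.sum_tmul,
      v.sum_repr']
  | add x y hx hy => simp [TensorProduct.tmul_add, Finset.sum_add_distrib, hx, hy]

theorem bra_eq_sum {ι : Type*} [Fintype ι] (v : OrthonormalBasis ι ℂ S) (s : S) (ψ : S ⊗[ℂ] A) :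
    bra A s ψ = ∑ j, ⟪s, v j⟫_ℂ • bra A (v j) ψ := by
  conv_lhs => rw [← sum_tmul_bra v ψ]
  simp

/-- The partial trace of `|ψ⟩⟨ψ|` does not depend on the orthonormal basis it is computed in. -/
theorem sum_rankOne_bra_eq {ι κ : Type*} [Fintype ι] [Fintype κ] (e : OrthonormalBasis ι ℂ S)
    (v : OrthonormalBasis κ ℂ S) (ψ : S ⊗[ℂ] A) :
    ∑ i, InnerProductSpace.rankOne ℂ (bra A (e i) ψ) (bra A (e i) ψ) =
      ∑ j, InnerProductSpace.rankOne ℂ (bra A (v j) ψ) (bra A (v j) ψ) := by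
  ext a
  simp only [_root_.sum_apply, InnerProductSpace.rankOne_apply, inner_bra_left]
  calc ∑ i, ⟪ψ, e i ⊗ₜ[ℂ] a⟫_ℂ • bra A (e i) ψ
      = ∑ i, ∑ j, (⟪ψ, e i ⊗ₜ[ℂ] a⟫_ℂ * ⟪e i, v j⟫_ℂ) • bra A (v j) ψ := by
        refine Finset.sum_congr rfl fun i _ => ?_
        rw [bra_eq_sum v (e i)]
        simp only [Finset.smul_sum, smul_smul]
    _ = ∑ j, ⟪ψ, (∑ i, ⟪e i, v j⟫_ℂ • e i) ⊗ₜ[ℂ] a⟫_ℂ • bra A (v j) ψ := by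
        rw [Finset.sum_comm]
        refine Finset.sum_congr rfl fun j _ => ?_
        rw [← Finset.sum_smul]
        simp [TensorProduct.sum_tmul, inner_sum, inner_smul_tmul, mul_comm]
    _ = _ := by simp only [e.sum_repr']

variable [FiniteDimensional ℂ S]

/-- The apparatus state is the partial trace of `|ψ⟩⟨ψ|` for `ψ = U (q ⊗ Ω)`. -/
theorem apparatusState_eq_sum {ι : Type*} [Fintype ι] (v : OrthonormalBasis ι ℂ S)
    (U : (S ⊗[ℂ] A) ≃ₗᵢ[ℂ] (S ⊗[ℂ] A)) (q : S) (Ω : A) :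
    apparatusState U q Ω = ∑ i, InnerProductSpace.rankOne ℂ
      (bra A (v i) (U (q ⊗ₜ Ω))) (bra A (v i) (U (q ⊗ₜ Ω))) := by
  rw [← sum_rankOne_bra_eq (stdOrthonormalBasis ℂ S) v]
  have hP (x : S ⊗[ℂ] A) : TensorProduct.mapL (InnerProductSpace.rankOne ℂ q q)
      (InnerProductSpace.rankOne ℂ Ω Ω) x = ⟪q ⊗ₜ[ℂ] Ω, x⟫_ℂ • q ⊗ₜ[ℂ] Ω := by
    induction x using TensorProduct.induction_on with
    | zero => simp
    | tmul x y => simp [TensorProduct.tmul_smul, TensorProduct.smul_tmul', smul_smul, mul_comm]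
    | add x y hx hy => rw [map_add, hx, hy, inner_add_right, add_smul]
  unfold apparatusState partialTrace
  refine Finset.sum_congr rfl fun i _ => ?_
  ext a
  have h (y : S ⊗[ℂ] A) : ⟪q ⊗ₜ[ℂ] Ω, U.symm y⟫_ℂ = ⟪U (q ⊗ₜ[ℂ] Ω), y⟫_ℂ := by
    rw [← U.inner_map_map, U.apply_symm_apply]
  simp only [ContinuousLinearMap.comp_apply, InnerProductSpace.rankOne_apply, inner_bra_left]
  change bra A _ (U (TensorProduct.mapL _ _ (U.symm (_ ⊗ₜ[ℂ] a)))) = _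
  rw [hP, map_smul, map_smul, h]

/-- Schmidt decomposition: the components of a vector of `S ⊗ A` with respect to a suitable
orthonormal basis of `S` are orthogonal. That basis consists of the eigenvectors of the reduced
operator `G` on `S` given by `⟪s, G t⟫ = ⟪(⟨t| ⊗ 1) Φ, (⟨s| ⊗ 1) Φ⟫`. -/
theorem exists_orthonormalBasis_pairwise_inner_bra_eq_zero (Φ : S ⊗[ℂ] A) :
    ∃ v : OrthonormalBasis (Fin (Module.finrank ℂ S)) ℂ S,
      Pairwise fun i j => ⟪bra A (v i) Φ, bra A (v j) Φ⟫_ℂ = 0 := by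
  let e := stdOrthonormalBasis ℂ S
  let G : S →ₗ[ℂ] S :=
    { toFun := fun t => ∑ i, ⟪Φ, t ⊗ₜ[ℂ] bra A (e i) Φ⟫_ℂ • e i
      map_add' := fun x y => by
        simp [TensorProduct.add_tmul, inner_add_right, add_smul, Finset.sum_add_distrib]
      map_smul' := fun c x => by
        simp [inner_smul_tmul, smul_smul, Finset.smul_sum] }
  have hG (s t : S) : ⟪s, G t⟫_ℂ = ⟪bra A t Φ, bra A s Φ⟫_ℂ := by
    rw [bra_eq_sum e s, inner_sum]
    simp only [G, LinearMap.coe_mk, AddHom.coe_mk, inner_sum, inner_smul_right, inner_bra_left,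
      mul_comm]
  have hsymm : G.IsSymmetric := fun s t => by
    rw [← inner_conj_symm, hG, hG, inner_conj_symm]
  refine ⟨hsymm.eigenvectorBasis rfl, fun i j hij => ?_⟩
  change ⟪bra A _ Φ, bra A _ Φ⟫_ℂ = 0
  rw [← hG, hsymm.apply_eigenvectorBasis, inner_smul_right, OrthonormalBasis.inner_eq_zero _ hij.symm,
    mul_zero]

variable [CompleteSpace A]

theorem apparatusState_nonneg (U : (S ⊗[ℂ] A) ≃ₗᵢ[ℂ] (S ⊗[ℂ] A)) (q : S) (Ω : A) :
    0 ≤ apparatusState U q Ω := by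
  rw [apparatusState_eq_sum (stdOrthonormalBasis ℂ S)]
  exact Finset.sum_nonneg fun i _ => (ContinuousLinearMap.nonneg_iff_isPositive _).2
    (InnerProductSpace.isPositive_rankOne_self _)

/-- Cauchy-Schwarz against a purification `ψ = U (q ⊗ Ω)` of the apparatus state `σ`. -/
theorem norm_inner_tmul_le (U : (S ⊗[ℂ] A) ≃ₗᵢ[ℂ] (S ⊗[ℂ] A)) (q : S) (Ω : A) (s : S) (a : A) :
    ‖⟪U (q ⊗ₜ[ℂ] Ω), s ⊗ₜ[ℂ] a⟫_ℂ‖ ≤ ‖s‖ * ‖CFC.sqrt (apparatusState U q Ω) a‖ := by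
  set ψ := U (q ⊗ₜ[ℂ] Ω) with hψ
  let e := stdOrthonormalBasis ℂ S
  -- `g` represents the functional `s ↦ ⟪ψ, s ⊗ a⟫`, and `‖g‖² = ⟪a, σ a⟫`.
  let g : S := ∑ i, (starRingEnd ℂ) ⟪ψ, e i ⊗ₜ[ℂ] a⟫_ℂ • e i
  have hg (s : S) : ⟪g, s⟫_ℂ = ⟪ψ, s ⊗ₜ[ℂ] a⟫_ℂ := by
    conv_rhs => rw [← e.sum_repr' s]
    simp [g, TensorProduct.sum_tmul, inner_sum, inner_smul_tmul]

  have hnorm : ‖g‖ = ‖CFC.sqrt (apparatusState U q Ω) a‖ := by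
    rw [← sq_eq_sq₀ (norm_nonneg _) (norm_nonneg _), ← Complex.ofReal_inj]
    have h1 : ⟪CFC.sqrt (apparatusState U q Ω) a, CFC.sqrt (apparatusState U q Ω) a⟫_ℂ
        = ⟪g, g⟫_ℂ := by
      rw [inner_sqrt_left, sqrt_sqrt_apply (apparatusState_nonneg U q Ω), apparatusState_eq_sum e,
        ← hψ, _root_.sum_apply, inner_sum, ← e.sum_inner_mul_inner g g]
      refine Finset.sum_congr rfl fun i _ => ?_
      rw [InnerProductSpace.rankOne_apply, inner_smul_right, inner_bra_left, hg,
        ← inner_conj_symm (e i) g, hg, ← inner_conj_symm a, inner_bra_left]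
    rw [inner_self_eq_norm_sq_to_K, inner_self_eq_norm_sq_to_K] at h1
    push_cast
    exact h1.symm
  rw [← hg, ← hnorm, mul_comm]
  exact norm_inner_le_norm g s

/-- The half of Uhlmann's theorem that bounds overlaps of purifications by the fidelity, with an
arbitrary operator `T` on the purifying space `S` in place of a unitary. -/
theorem enorm_inner_rTensor_le (U : (S ⊗[ℂ] A) ≃ₗᵢ[ℂ] (S ⊗[ℂ] A)) (q₀ q₁ : S) (Ω : A)
    (T : S →L[ℂ] S) :
    ‖⟪U (q₁ ⊗ₜ[ℂ] Ω), T.rTensor A (U (q₀ ⊗ₜ[ℂ] Ω))⟫_ℂ‖ₑ ≤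
      ‖T‖ₑ * fidelity (apparatusState U q₀ Ω) (apparatusState U q₁ Ω) := by
  set ρ := apparatusState U q₀ Ω
  set σ := apparatusState U q₁ Ω with hσ
  set ψ₀ := U (q₀ ⊗ₜ[ℂ] Ω) with hψ₀
  set ψ₁ := U (q₁ ⊗ₜ[ℂ] Ω) with hψ₁
  set D := CFC.sqrt σ with hD
  obtain ⟨v, hv⟩ := exists_orthonormalBasis_pairwise_inner_bra_eq_zero (D.lTensor S ψ₀)
  simp only [bra_lTensor] at hv
  have hDsa : IsSelfAdjoint D := .of_nonneg (CFC.sqrt_nonneg σ)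
  have hR : 0 ≤ D * ρ * D := hDsa.conjugate_nonneg (apparatusState_nonneg U q₀ Ω)
  have hRw (k) : (D * ρ * D) (D (bra A (v k) ψ₀)) =
      ((‖D (bra A (v k) ψ₀)‖ : ℂ) ^ 2) • D (bra A (v k) ψ₀) := by
    have hρ : ρ = _ := apparatusState_eq_sum v U q₀ Ω
    rw [mul_apply_eq_comp, mul_apply_eq_comp, hρ,
      _root_.sum_apply, map_sum, Finset.sum_eq_single k]
    · rw [InnerProductSpace.rankOne_apply, map_smul, ← hψ₀, hD, ← inner_sqrt_left, ← hD,
        inner_self_eq_norm_sq_to_K]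
      rfl
    · intro j _ hj
      rw [InnerProductSpace.rankOne_apply, map_smul, ← hψ₀, hD, ← inner_sqrt_left, ← hD, hv hj,
        zero_smul]
    · simp
  have hterm (k) : ‖⟪ψ₁, T (v k) ⊗ₜ[ℂ] bra A (v k) ψ₀⟫_ℂ‖ₑ ≤ ‖T‖ₑ * ‖D (bra A (v k) ψ₀)‖ₑ := by
    rw [← ofReal_norm, ← ofReal_norm, ← ofReal_norm, ← ENNReal.ofReal_mul (norm_nonneg _)]
    refine ENNReal.ofReal_le_ofReal ((norm_inner_tmul_le U q₁ Ω _ _).trans ?_)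
    gcongr
    simpa using T.le_opNorm (v k)
  calc ‖⟪ψ₁, T.rTensor A ψ₀⟫_ℂ‖ₑ
      = ‖∑ k, ⟪ψ₁, T (v k) ⊗ₜ[ℂ] bra A (v k) ψ₀⟫_ℂ‖ₑ := by
        conv_lhs => rw [← sum_tmul_bra v ψ₀]
        rw [map_sum, inner_sum]
        rfl
    _ ≤ ∑ k, ‖T‖ₑ * ‖D (bra A (v k) ψ₀)‖ₑ :=
        (enorm_sum_le _ _).trans (Finset.sum_le_sum fun k _ => hterm k)
    _ = ‖T‖ₑ * ∑ k, ‖D (bra A (v k) ψ₀)‖ₑ := by rw [Finset.mul_sum]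
    _ ≤ _ := by
        gcongr
        exact sum_enorm_le_posTrace_sqrt hv hR hRw

end Reduction

/-! ### Generators of unitary groups and commutators -/

section Evolution

variable {E : Type*} [NormedAddCommGroup E] [InnerProductSpace ℂ E]

/-- Also for a non-closable `T`, where `T.closure` is `T` itself. -/
theorem mem_closure_graph_of_mem_graph_closure (T : E →ₗ.[ℂ] E) {p : E × E}
    (hp : p ∈ T.closure.graph) : p ∈ _root_.closure (T.graph : Set (E × E)) := by
  by_cases hT : T.IsClosable
  · rw [← hT.graph_closure_eq_closure_graph] at hp
    exact hp
  · rw [LinearPMap.closure_def' hT] at hp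
    exact subset_closure hp

/-- A bound on the form of the commutator `[T, B]` passes to the closure of `T` by continuity. -/
theorem norm_inner_sub_inner_le_of_mem_graph_closure {T : E →ₗ.[ℂ] E} {B : E →L[ℂ] E} {C : ℝ}
    (hT : ∀ x y : T.domain, ‖⟪T x, B y⟫_ℂ - ⟪(x : E), B (T y)⟫_ℂ‖ ≤ C * ‖(x : E)‖ * ‖(y : E)‖)
    {φ φ' χ χ' : E} (hφ : (φ, φ') ∈ T.closure.graph) (hχ : (χ, χ') ∈ T.closure.graph) :
    ‖⟪φ', B χ⟫_ℂ - ⟪φ, B χ'⟫_ℂ‖ ≤ C * ‖φ‖ * ‖χ‖ := by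
  have hP : IsClosed {p : (E × E) × (E × E) |
      ‖⟪p.1.2, B p.2.1⟫_ℂ - ⟪p.1.1, B p.2.2⟫_ℂ‖ ≤ C * ‖p.1.1‖ * ‖p.2.1‖} :=
    isClosed_le (by fun_prop) (by fun_prop)
  have hmem := Set.mk_mem_prod (mem_closure_graph_of_mem_graph_closure T hφ)
    (mem_closure_graph_of_mem_graph_closure T hχ)
  rw [← closure_prod_eq] at hmem
  refine closure_minimal ?_ hP hmem
  rintro ⟨⟨x, x'⟩, ⟨y, y'⟩⟩ ⟨hx, hy⟩
  obtain ⟨x, rfl, rfl⟩ := T.mem_graph_iff.1 hx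
  obtain ⟨y, rfl, rfl⟩ := T.mem_graph_iff.1 hy
  exact hT x y

variable {ħ : ℝ} {H : E →ₗ.[ℂ] E} {U : ℝ → (E ≃ₗᵢ[ℂ] E)}

namespace IsTimeEvolution

theorem zero_apply (hU : IsTimeEvolution ħ H U) (φ : E) : U 0 φ = φ :=
  (U 0).injective (by rw [← hU.add, add_zero])

theorem mem_graph (hU : IsTimeEvolution ħ H U) {φ χ : E} (h : (φ, χ) ∈ H.graph) (t : ℝ) :
    (U t φ, U t χ) ∈ H.graph := by
  rw [hU.generator] at h ⊢
  have h1 := (U t).toContinuousLinearEquiv.toContinuousLinearMap.restrictScalars ℝ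
    |>.hasFDerivAt.comp_hasDerivAt (0 : ℝ) h
  convert h1 using 1
  · ext s
    change U s (U t φ) = U t (U s φ)
    rw [← hU.add, ← hU.add, add_comm]
  · change _ = U t _
    rw [map_smul]

theorem hasDerivAt (hU : IsTimeEvolution ħ H U) {φ χ : E} (h : (φ, χ) ∈ H.graph) (t : ℝ) :
    HasDerivAt (fun s => U s φ) (-(Complex.I / (ħ : ℂ)) • U t χ) t := by
  have h1 := (hU.generator _ _).1 (hU.mem_graph h t)
  rw [← sub_self t] at h1
  have h2 := h1.comp_sub_const t t
  refine h2.congr_of_eventuallyEq (.of_forall fun s => ?_)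
  simp only [← hU.add, sub_add_cancel]

/-- The domain of the generator is dense: it contains the averages `h⁻¹ ∫ s in 0..h, U s φ`, which
tend to `φ` as `h → 0`. -/
theorem dense_domain [CompleteSpace E] (hħ : ħ ≠ 0) (hU : IsTimeEvolution ħ H U) :
    Dense (H.domain : Set E) := by
  intro φ
  let F : ℝ → E := fun u => ∫ s in (0 : ℝ)..u, U s φ
  have hint (a b : ℝ) : IntervalIntegrable (fun s => U s φ) MeasureTheory.volume a b :=
    (hU.continuous φ).intervalIntegrable a b
  have hF (u : ℝ) : HasDerivAt F (U u φ) u :=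
    intervalIntegral.integral_hasDerivAt_right (hint 0 u)
      ((hU.continuous φ).stronglyMeasurableAtFilter _ _) (hU.continuous φ).continuousAt
  have hmem (h : ℝ) : F h ∈ H.domain := by
    refine LinearPMap.mem_domain_iff.2 ⟨(Complex.I * ħ) • (U h φ - φ), (hU.generator _ _).2 ?_⟩
    have h1 (t : ℝ) : U t (F h) = F (h + t) - F t := by
      have h2 := (U t).toContinuousLinearEquiv.toContinuousLinearMap.intervalIntegral_comp_comm
        (hint 0 h)
      change _ = U t (F h) at h2
      rw [← h2]
      change ∫ s in (0 : ℝ)..h, U t (U s φ) = _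
      simp only [← hU.add]
      rw [intervalIntegral.integral_comp_add_left (fun s => U s φ) t,
        intervalIntegral.integral_interval_sub_left (hint _ _) (hint _ _), add_zero, add_comm]
    have h3 : -(Complex.I / (ħ : ℂ)) • (Complex.I * ħ) • (U h φ - φ) = U h φ - φ := by
      have : (ħ : ℂ) ≠ 0 := by exact_mod_cast hħ
      rw [smul_smul]
      have h4 : -(Complex.I / (ħ : ℂ)) * (Complex.I * ħ) = 1 := by
        field_simp
        simp
      rw [h4, one_smul]
    rw [h3, funext h1]
    refine HasDerivAt.sub ?_ ?_
    · have h5 := hF (h + 0)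
      have h6 := h5.comp_const_add h 0
      simpa only [add_zero] using h6
    · simpa only [hU.zero_apply] using hF 0
  have hlim := (hF 0).tendsto_slope_zero_right
  rw [hU.zero_apply] at hlim
  refine mem_closure_of_tendsto hlim (.of_forall fun h => ?_)
  have hF0 : F 0 = 0 := intervalIntegral.integral_same
  rw [zero_add, hF0, sub_zero]
  exact (H.domain.restrictScalars ℝ).smul_mem _ (hmem h)

/-- If the form `⟪H φ, B χ⟫ - ⟪φ, B (H χ)⟫` of the commutator `[H, B]` is bounded by `C`, then the
Heisenberg evolution moves `B` by at most `C t / ħ` up to the time `t`. -/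
theorem norm_inner_sub_inner_le [CompleteSpace E] (hħ : 0 < ħ) (hU : IsTimeEvolution ħ H U)
    (B : E →L[ℂ] E) {C : ℝ}
    (hC : ∀ φ φ' χ χ', (φ, φ') ∈ H.graph → (χ, χ') ∈ H.graph →
      ‖⟪φ', B χ⟫_ℂ - ⟪φ, B χ'⟫_ℂ‖ ≤ C * ‖φ‖ * ‖χ‖) {t : ℝ} (ht : 0 ≤ t) (φ χ : E) :
    ‖⟪U t φ, B (U t χ)⟫_ℂ - ⟪φ, B χ⟫_ℂ‖ ≤ C * ‖φ‖ * ‖χ‖ * (t / ħ) := by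
  have hdom : ∀ φ ∈ H.domain, ∀ χ ∈ H.domain,
      ‖⟪U t φ, B (U t χ)⟫_ℂ - ⟪φ, B χ⟫_ℂ‖ ≤ C * ‖φ‖ * ‖χ‖ * (t / ħ) := by
    intro φ hφ χ hχ
    obtain ⟨φ', hφ'⟩ := LinearPMap.mem_domain_iff.1 hφ
    obtain ⟨χ', hχ'⟩ := LinearPMap.mem_domain_iff.1 hχ
    have hder (s : ℝ) := (hU.hasDerivAt hφ' s).inner ℂ
      ((B.restrictScalars ℝ).hasFDerivAt.comp_hasDerivAt s (hU.hasDerivAt hχ' s))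
    have hbound := norm_image_sub_le_of_norm_deriv_le_segment' (a := 0) (b := t)
      (C := C * ‖φ‖ * ‖χ‖ / ħ) (fun s _ => (hder s).hasDerivWithinAt) (fun s _ => by
        have h1 := hC _ _ _ _ (hU.mem_graph hφ' s) (hU.mem_graph hχ' s)
        simp only [LinearIsometryEquiv.norm_map] at h1
        change ‖⟪U s φ, B (-(Complex.I / (ħ : ℂ)) • U s χ')⟫_ℂ
          + ⟪-(Complex.I / (ħ : ℂ)) • U s φ', B (U s χ)⟫_ℂ‖ ≤ _
        have h2 : ⟪U s φ, B (-(Complex.I / (ħ : ℂ)) • U s χ')⟫_ℂ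
            + ⟪-(Complex.I / (ħ : ℂ)) • U s φ', B (U s χ)⟫_ℂ
            = (Complex.I / (ħ : ℂ)) * (⟪U s φ', B (U s χ)⟫_ℂ - ⟪U s φ, B (U s χ')⟫_ℂ) := by
          rw [map_smul, inner_smul_right, inner_smul_left]
          simp only [map_neg, map_div₀, Complex.conj_I, Complex.conj_ofReal]
          ring
        rw [h2, norm_mul, norm_div, Complex.norm_I, Complex.norm_real, Real.norm_of_nonneg hħ.le,
          div_mul_eq_mul_div, one_mul]
        gcongr) t ⟨ht, le_rfl⟩
    change ‖⟪U t φ, B (U t χ)⟫_ℂ - ⟪U 0 φ, B (U 0 χ)⟫_ℂ‖ ≤ _ at hbound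
    rw [hU.zero_apply, hU.zero_apply, sub_zero] at hbound
    exact hbound.trans_eq (by ring)
  have hclosed : IsClosed {p : E × E | ‖⟪U t p.1, B (U t p.2)⟫_ℂ - ⟪p.1, B p.2⟫_ℂ‖
      ≤ C * ‖p.1‖ * ‖p.2‖ * (t / ħ)} :=
    isClosed_le (by fun_prop) (by fun_prop)
  have hd := hU.dense_domain hħ.ne'
  exact closure_minimal (fun p hp => hdom p.1 hp.1 p.2 hp.2) hclosed
    ((hd.prod hd).closure_eq ▸ Set.mem_univ (φ, χ))

end IsTimeEvolution

/-- A finite norm of `[V, B]` provides the domain inclusion. -/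
theorem exists_mem_domain_norm_commutator_le {V : E →ₗ.[ℂ] E} {B : E →L[ℂ] E}
    (h : commutatorNorm V B ≠ ∞) (φ : V.domain) :
    ∃ hφ : B φ ∈ V.domain,
      ‖V ⟨B φ, hφ⟩ - B (V φ)‖ ≤ (commutatorNorm V B).toReal * ‖(φ : E)‖ := by
  rcases eq_or_ne φ 0 with rfl | h0
  · have h1 : B ((0 : V.domain) : E) = 0 := by simp
    have hmem : B ((0 : V.domain) : E) ∈ V.domain := by rw [h1]; exact zero_mem _
    refine ⟨hmem, ?_⟩
    have h2 : (⟨B ((0 : V.domain) : E), hmem⟩ : V.domain) = 0 := Subtype.ext h1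
    rw [h2, V.map_zero, map_zero, sub_zero, norm_zero]
    positivity
  · have hle : (open Classical in if h : B φ ∈ V.domain then
        ‖V ⟨B φ, h⟩ - B (V φ)‖ₑ / ‖(φ : E)‖ₑ else ∞) ≤ commutatorNorm V B :=
      le_iSup₂ (f := fun (φ : V.domain) (_ : φ ≠ 0) => open Classical in
        if h : B φ ∈ V.domain then ‖V ⟨B φ, h⟩ - B (V φ)‖ₑ / ‖(φ : E)‖ₑ else ∞) φ h0
    by_cases hφ : B φ ∈ V.domain
    · refine ⟨hφ, ?_⟩
      rw [dif_pos hφ, ENNReal.div_le_iff (by simpa using h0) (by simp)] at hle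
      have := ENNReal.toReal_mono (ENNReal.mul_ne_top h (by simp)) hle
      simpa using this
    · rw [dif_neg hφ] at hle
      exact absurd (top_le_iff.1 hle) h

theorem norm_inner_sub_inner_le_of_isFormalAdjoint {V : E →ₗ.[ℂ] E} (hV : V.IsFormalAdjoint V)
    {B : E →L[ℂ] E} (h : commutatorNorm V B ≠ ∞) (φ χ : V.domain) :
    ‖⟪V φ, B χ⟫_ℂ - ⟪(φ : E), B (V χ)⟫_ℂ‖ ≤
      (commutatorNorm V B).toReal * ‖(φ : E)‖ * ‖(χ : E)‖ := by
  obtain ⟨hχ, hle⟩ := exists_mem_domain_norm_commutator_le h χ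
  have h1 : ⟪V φ, B χ⟫_ℂ = ⟪(φ : E), V ⟨B χ, hχ⟩⟫_ℂ := hV φ ⟨B χ, hχ⟩
  rw [h1, ← inner_sub_right]
  calc _ ≤ ‖(φ : E)‖ * ‖V ⟨B χ, hχ⟩ - B (V χ)‖ := norm_inner_le_norm _ _
    _ ≤ ‖(φ : E)‖ * ((commutatorNorm V B).toReal * ‖(χ : E)‖) := by gcongr
    _ = _ := by ring

end Evolution

/-! ### The total Hamiltonian -/

section Composite

variable {S A : Type*} [NormedAddCommGroup S] [InnerProductSpace ℂ S]
  [NormedAddCommGroup A] [InnerProductSpace ℂ A]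

theorem completeSpace_tensorProduct (S A : Type*) [NormedAddCommGroup S] [InnerProductSpace ℂ S]
    [FiniteDimensional ℂ S] [NormedAddCommGroup A] [InnerProductSpace ℂ A] [CompleteSpace A] :
    CompleteSpace (S ⊗[ℂ] A) := by
  let e := stdOrthonormalBasis ℂ S
  let L : (S ⊗[ℂ] A) ≃L[ℂ] (Fin (Module.finrank ℂ S) → A) :=
    .equivOfInverse (.pi fun i => bra A (e i))
      (∑ i, TensorProduct.mkL ℂ S A (e i) ∘L ContinuousLinearMap.proj i)
      (fun x => by simpa using sum_tmul_bra e x)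
      (fun a => by ext i; simp [e.inner_eq_ite])
  exact (completeSpace_congr (e := L.toEquiv) L.isUniformEmbedding).2 inferInstance

/-- `1 ⊗ T` is symmetric if `T` is, and commutes with `B ⊗ 1`. -/
theorem inner_idTensor_rTensor {T : A →ₗ.[ℂ] A} (hT : T.IsFormalAdjoint T) (B : S →L[ℂ] S)
    (x y : (idTensor S T).domain) :
    ⟪idTensor S T x, B.rTensor A y⟫_ℂ = ⟪(x : S ⊗[ℂ] A), B.rTensor A (idTensor S T y)⟫_ℂ := by
  have hinj := Module.Flat.lTensor_preserves_injective_linearMap (M := S) _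
    T.domain.injective_subtype
  obtain ⟨x, rfl⟩ := (LinearEquiv.ofInjective _ hinj).surjective x
  obtain ⟨y, rfl⟩ := (LinearEquiv.ofInjective _ hinj).surjective y
  have happ (z : S ⊗[ℂ] T.domain) :
      idTensor S T (LinearEquiv.ofInjective _ hinj z) = T.toFun.lTensor S z :=
    congrArg (T.toFun.lTensor S) ((LinearEquiv.ofInjective _ hinj).symm_apply_apply z)
  rw [happ, happ]
  change ⟪T.toFun.lTensor S x, B.rTensor A (T.domain.subtype.lTensor S y)⟫_ℂ
    = ⟪T.domain.subtype.lTensor S x, B.rTensor A (T.toFun.lTensor S y)⟫_ℂ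
  induction x using TensorProduct.induction_on with
  | zero => simp
  | add x x' hx hx' => simp only [map_add, inner_add_left, hx, hx']
  | tmul s a =>
    induction y using TensorProduct.induction_on with
    | zero => simp
    | add y y' hy hy' => simp only [map_add, inner_add_right, hy, hy']
    | tmul s' a' =>
      have h : ⟪T a, (a' : A)⟫_ℂ = ⟪(a : A), T a'⟫_ℂ := hT a a'
      simp [h]

/-- `H_S ⊗ 1` commutes with the first two summands of the Hamiltonian, so only `V` contributes to
its commutator. -/
theorem norm_inner_sub_inner_le_of_mem_graph_totalHamiltonian [CompleteSpace S]
    {HS : S →L[ℂ] S} (hHS : IsSelfAdjoint HS) {HA : A →ₗ.[ℂ] A} (hHA : HA.IsFormalAdjoint HA)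
    {V : (S ⊗[ℂ] A) →ₗ.[ℂ] (S ⊗[ℂ] A)} (hV : V.IsFormalAdjoint V)
    (h : commutatorNorm V (HS.rTensor A) ≠ ∞) {φ φ' χ χ' : S ⊗[ℂ] A}
    (hφ : (φ, φ') ∈ (totalHamiltonian HS HA V).graph)
    (hχ : (χ, χ') ∈ (totalHamiltonian HS HA V).graph) :
    ‖⟪φ', HS.rTensor A χ⟫_ℂ - ⟪φ, HS.rTensor A χ'⟫_ℂ‖ ≤
      (commutatorNorm V (HS.rTensor A)).toReal * ‖φ‖ * ‖χ‖ := by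
  set B := HS.rTensor A with hB
  have hBsymm (x y : S ⊗[ℂ] A) : ⟪B x, y⟫_ℂ = ⟪x, B y⟫_ℂ := by
    induction x using TensorProduct.induction_on with
    | zero => simp
    | add x x' hx hx' => simp only [map_add, inner_add_left, hx, hx']
    | tmul s a =>
      induction y using TensorProduct.induction_on with
      | zero => simp
      | add y y' hy hy' => simp only [map_add, inner_add_right, hy, hy']
      | tmul s' a' =>
        have h1 : ⟪HS s, s'⟫_ℂ = ⟪s, HS s'⟫_ℂ := hHS.isSymmetric s s'
        simp [hB, h1]
  refine norm_inner_sub_inner_le_of_mem_graph_closure (fun x y => ?_) hφ hχ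
  have h1 := inner_idTensor_rTensor hHA HS ⟨x, x.2.1.2⟩ ⟨y, y.2.1.2⟩
  have h2 := norm_inner_sub_inner_le_of_isFormalAdjoint hV h ⟨x, x.2.2⟩ ⟨y, y.2.2⟩
  rw [← hB] at h1
  have h3 (z : (B.toLinearMap.toPMap ⊤ + idTensor S HA + V).domain) :
      (B.toLinearMap.toPMap ⊤ + idTensor S HA + V) z =
        B z + idTensor S HA ⟨z, z.2.1.2⟩ + V ⟨z, z.2.2⟩ := rfl
  rw [h3, h3, inner_add_left, inner_add_left, map_add, map_add, inner_add_right, inner_add_right,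
    h1, hBsymm, add_sub_add_left_eq_sub]
  exact h2

end Composite

/-! ### Commutators with a projection on a two-dimensional space -/

section Commutator

variable {S : Type*} [NormedAddCommGroup S] [InnerProductSpace ℂ S]

/-- In an orthonormal basis of eigenvectors of `Q` the commutator `[Q, T]` is off-diagonal, with
entries `⟪q₁, T q₀⟫` and, up to sign, its conjugate. -/
theorem norm_commutator_le [CompleteSpace S] [FiniteDimensional ℂ S] (hS : Module.finrank ℂ S = 2)
    {T Q : S →L[ℂ] S} (hT : IsSelfAdjoint T) (hQ : IsSelfAdjoint Q) {q₀ q₁ : S}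
    (hq₀ : ‖q₀‖ = 1) (hq₁ : ‖q₁‖ = 1) (hQ₀ : Q q₀ = 0) (hQ₁ : Q q₁ = q₁) :
    ‖Q * T - T * Q‖ ≤ ‖⟪q₁, T q₀⟫_ℂ‖ := by
  have hQs (x y : S) : ⟪Q x, y⟫_ℂ = ⟪x, Q y⟫_ℂ := hQ.isSymmetric x y
  have hTs (x y : S) : ⟪T x, y⟫_ℂ = ⟪x, T y⟫_ℂ := hT.isSymmetric x y
  have h10 : ⟪q₁, q₀⟫_ℂ = 0 := by rw [← hQ₁, hQs, hQ₀, inner_zero_right]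
  have h01 : ⟪q₀, q₁⟫_ℂ = 0 := inner_eq_zero_symm.1 h10
  have hv : Orthonormal ℂ ![q₀, q₁] := by
    refine ⟨fun i => ?_, fun i j hij => ?_⟩
    · fin_cases i <;> simp [hq₀, hq₁]
    · fin_cases i <;> fin_cases j <;> simp_all
  let b : OrthonormalBasis (Fin 2) ℂ S := OrthonormalBasis.mk hv
    (by rw [hv.linearIndependent.span_eq_top_of_card_eq_finrank' (by simp [hS])])
  have hb0 : b 0 = q₀ := by simp [b]
  have hb1 : b 1 = q₁ := by simp [b]
  refine ContinuousLinearMap.opNorm_le_bound _ (norm_nonneg _) fun x => ?_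
  set K := Q * T - T * Q with hK
  have hKx : K x = Q (T x) - T (Q x) := rfl
  have hx := b.sum_repr' x
  rw [Fin.sum_univ_two, hb0, hb1] at hx
  have hQx : Q x = ⟪q₁, x⟫_ℂ • q₁ := by
    conv_lhs => rw [← hx]
    rw [map_add, map_smul, map_smul, hQ₀, hQ₁, smul_zero, zero_add]
  have e0 : ⟪q₀, K x⟫_ℂ = -(⟪q₁, x⟫_ℂ * ⟪q₀, T q₁⟫_ℂ) := by
    rw [hKx, inner_sub_right, ← hQs, hQ₀, inner_zero_left, hQx, map_smul, inner_smul_right,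
      zero_sub]
  have e1 : ⟪q₁, K x⟫_ℂ = ⟪q₀, x⟫_ℂ * ⟪q₁, T q₀⟫_ℂ := by
    rw [hKx, inner_sub_right, ← hQs, hQ₁, hQx]
    conv_lhs => rw [← hx]
    simp only [map_add, map_smul, inner_add_right, inner_smul_right, h10]
    rw [inner_self_eq_norm_sq_to_K, hq₁]
    simp
  have hsymm : ‖⟪q₀, T q₁⟫_ℂ‖ = ‖⟪q₁, T q₀⟫_ℂ‖ := by rw [← hTs, norm_inner_symm]
  refine le_of_sq_le_sq ?_ (by positivity)
  rw [mul_pow, ← b.sum_sq_norm_inner_right, ← b.sum_sq_norm_inner_right x]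
  simp only [Fin.sum_univ_two, hb0, hb1, e0, e1, norm_neg, norm_mul, hsymm]
  apply le_of_eq
  ring

end Commutator

end QMeasurement

theorem theorem1
    {S A : Type*}
    [NormedAddCommGroup S] [InnerProductSpace ℂ S] [CompleteSpace S] [FiniteDimensional ℂ S]
    [NormedAddCommGroup A] [InnerProductSpace ℂ A] [CompleteSpace A]
    (hS : Module.finrank ℂ S = 2)
    (ħ : ℝ) (hħ : 0 < ħ)
    (HS : S →L[ℂ] S) (hHS : IsSelfAdjoint HS)
    (HA : A →ₗ.[ℂ] A) (hHA : HA.IsFormalAdjoint HA)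
    (V : (S ⊗[ℂ] A) →ₗ.[ℂ] (S ⊗[ℂ] A)) (hV : V.IsFormalAdjoint V)
    (U : ℝ → ((S ⊗[ℂ] A) ≃ₗᵢ[ℂ] (S ⊗[ℂ] A)))
    (hU : QMeasurement.IsTimeEvolution ħ (QMeasurement.totalHamiltonian HS HA V) U)
    (Q : S →L[ℂ] S) (hQ : IsStarProjection Q)
    (q₀ q₁ : S) (hq₀ : ‖q₀‖ = 1) (hq₁ : ‖q₁‖ = 1) (hQ₀ : Q q₀ = 0) (hQ₁ : Q q₁ = q₁)
    (Ω : A) (hΩ : ‖Ω‖ = 1) (τ : ℝ) (hτ : 0 ≤ τ) :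
    ‖Q * HS - HS * Q‖ₑ ≤
      ‖HS‖ₑ * QMeasurement.fidelity
          (QMeasurement.apparatusState (U τ) q₀ Ω) (QMeasurement.apparatusState (U τ) q₁ Ω)
        + ENNReal.ofReal (τ / ħ) * QMeasurement.commutatorNorm V (HS.rTensor A) := by
  have := QMeasurement.completeSpace_tensorProduct S A
  have hinit : ‖Q * HS - HS * Q‖ₑ ≤ ‖⟪q₁ ⊗ₜ[ℂ] Ω, HS.rTensor A (q₀ ⊗ₜ[ℂ] Ω)⟫_ℂ‖ₑ := by
    rw [← ofReal_norm, ← ofReal_norm]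
    refine ENNReal.ofReal_le_ofReal ?_
    have h := QMeasurement.norm_commutator_le hS hHS hQ.isSelfAdjoint hq₀ hq₁ hQ₀ hQ₁
    rw [ContinuousLinearMap.rTensor_tmul, TensorProduct.inner_tmul, inner_self_eq_norm_sq_to_K, hΩ]
    simpa using h
  have hmove : ‖⟪U τ (q₁ ⊗ₜ[ℂ] Ω), HS.rTensor A (U τ (q₀ ⊗ₜ[ℂ] Ω))⟫_ℂ
      - ⟪q₁ ⊗ₜ[ℂ] Ω, HS.rTensor A (q₀ ⊗ₜ[ℂ] Ω)⟫_ℂ‖ₑ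
      ≤ ENNReal.ofReal (τ / ħ) * QMeasurement.commutatorNorm V (HS.rTensor A) := by
    rcases hτ.eq_or_lt with rfl | hτ
    · simp [hU.zero_apply]
    by_cases htop : QMeasurement.commutatorNorm V (HS.rTensor A) = ∞
    · rw [htop, ENNReal.mul_top (by simpa using div_pos hτ hħ)]
      exact le_top
    have h := hU.norm_inner_sub_inner_le hħ (HS.rTensor A)
      (fun _ _ _ _ h h' => QMeasurement.norm_inner_sub_inner_le_of_mem_graph_totalHamiltonian
        hHS hHA hV htop h h') hτ.le (q₁ ⊗ₜ Ω) (q₀ ⊗ₜ Ω)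
    simp only [TensorProduct.norm_tmul, hq₀, hq₁, hΩ, mul_one] at h
    rw [← ofReal_norm, ← ENNReal.ofReal_toReal htop, ← ENNReal.ofReal_mul (by positivity), mul_comm]
    exact ENNReal.ofReal_le_ofReal h
  refine hinit.trans ?_
  have hsplit (z w : ℂ) : ‖w‖ₑ ≤ ‖z‖ₑ + ‖z - w‖ₑ := by
    simpa using enorm_sub_le (a := z) (b := z - w)
  exact (hsplit _ _).trans (add_le_add (QMeasurement.enorm_inner_rTensor_le _ _ _ _ _) hmove)
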